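/- A well-quasi-order (wqo) is a quasi-order (reflexive and transitive relation) in which every infinite sequence $x_0,x_1,\dots$ has $i<j$ with $x_i\le x_j$. For a wqo $A$, order the non-empty finite sequences of elements of $A$ by initial segment. Those that are bad (no $i<j$ with $x_i\le x_j$) form a well-founded tree $\mathrm{Bad}(A)$, and those whose entries are pairwise incomparable form a well-founded tree $\mathrm{Inco}(A)$. The rank of a node is $r(s)=\sup\{r(t)+1 : t \text{ a child of } s\}$ and the rank of a tree is $\sup_s (r(s)+1)$. The maximal order type $\boldsymbol{o}(A)$ is the rank of $\mathrm{Bad}(A)$, and the width $\boldsymbol{w}(A)$ is the rank of $\mathrm{Inco}(A)$. An ordinal $\alpha$ is indecomposable if $\beta+\gamma<\alpha$ for all $\beta,\gamma<\alpha$; $\otimes$ denotes the natural (Hessenberg) product of ordinals; and $A_1\times\dots\times A_n$ carries the componentwise order. \textbf{Theorem.} Let $A_1,\dots,A_n$ be wqos. Suppose that there are indices $i,j_1,j_2\in\{1,\dots,n\}$ with $j_1\neq j_2$ (the index $i$ may equal $j_1$ or $j_2$) such that $\boldsymbol{o}(A_i)$ is infinite and indecomposable, and such that all exponents in the Cantor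 normal forms of $\boldsymbol{o}(A_{j_1})$ and $\boldsymbol{o}(A_{j_2})$ are infinite. Then $$\boldsymbol{w}(A_1\times\dots\times A_n)=\boldsymbol{o}(A_1)\otimes\dots\otimes \boldsymbol{o}(A_n).$$ -/

import Mathlib

universe u

/-! ### Ordinal invariants of well-quasi-orders -/

/-- The nodes of a tree of finite sequences: the non-empty finite sequences `(x₁, …, xₙ)` of
elements of `α` such that `P xᵢ xⱼ` holds for all `i < j`. -/
def SeqTree {α : Type u} (P : α → α → Prop) : Type u :=
  {l : List α // l ≠ [] ∧ l.Pairwise P}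

/-- `t` is a child of `s` if `t` extends `s` by exactly one element. -/
def SeqTree.IsChild {α : Type u} {P : α → α → Prop} (t s : SeqTree P) : Prop :=
  ∃ y : α, t.1 = s.1 ++ [y]

/-- The tree is well-founded (has no infinite branch) as soon as its sequences are bad sequences
of a well-quasi-order. -/
theorem SeqTree.wellFounded_isChild {α : Type u} [LE α] [WellQuasiOrderedLE α]
    {P : α → α → Prop} (hP : ∀ x y, P x y → ¬ x ≤ y) :
    WellFounded (SeqTree.IsChild (P := P)) := by
  rw [wellFounded_iff_isEmpty_descending_chain]
  refine ⟨fun ⟨f, hf⟩ => ?_⟩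
  choose y hy using hf
  have hmem : ∀ m k, y m ∈ (f (m + 1 + k)).1 := by
    intro m k
    induction k with
    | zero => rw [Nat.add_zero, hy m]; simp
    | succ k ih => rw [← Nat.add_assoc, hy (m + 1 + k)]; exact List.mem_append_left _ ih
  obtain ⟨m, n, hmn, hle⟩ := wellQuasiOrdered_le (α := α) y
  obtain ⟨k, rfl⟩ := Nat.exists_eq_add_of_lt hmn
  have hn : y m ∈ (f (m + k + 1)).1 := by
    have := hmem m k
    rwa [Nat.add_right_comm] at this
  have hpw := (f (m + k + 1 + 1)).2.2
  rw [hy (m + k + 1), List.pairwise_append] at hpw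
  exact hP _ _ (hpw.2.2 _ hn _ (List.mem_singleton_self _)) hle

/-- The rank `sup_s (r(s) + 1)` of a well-founded tree (or forest) of sequences, where
`r(s) = sup {r(t) + 1 | t a child of s}`. -/
noncomputable def SeqTree.rank {α : Type u} (P : α → α → Prop)
    (h : WellFounded (SeqTree.IsChild (P := P))) : Ordinal.{u} :=
  ⨆ s : SeqTree P, Order.succ (h.apply s).rank

/-- The maximal order type `o(A)` of a well-quasi-order: the rank of its tree of non-empty bad
sequences (no element is below a later one). -/
noncomputable def maxOrderType (A : Type u) [LE A] [WellQuasiOrderedLE A] : Ordinal.{u} :=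
  SeqTree.rank (fun x y : A => ¬ x ≤ y) (SeqTree.wellFounded_isChild fun _ _ h => h)

/-- The width `w(A)` of a well-quasi-order: the rank of its tree of non-empty antichains
(sequences of pairwise incomparable elements). -/
noncomputable def wqoWidth (A : Type u) [LE A] [WellQuasiOrderedLE A] : Ordinal.{u} :=
  SeqTree.rank (fun x y : A => ¬ x ≤ y ∧ ¬ y ≤ x)
    (SeqTree.wellFounded_isChild fun _ _ h => h.1)

/-! ### Natural (Hessenberg) operations on ordinals -/

/-- The natural number coefficients of the Cantor normal form of `a`, indexed by the exponents. -/
noncomputable def cantorCoeff (a : Ordinal.{u}) : Ordinal.{u} →₀ ℕ :=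
  (Ordinal.CNF.coeff Ordinal.omega0 a).mapRange (fun x => Cardinal.toNat x.card) (by simp)

/-- The ordinal `ω ^ e₁ * f e₁ + ⋯ + ω ^ eₖ * f eₖ`, where `e₁ > ⋯ > eₖ` is the support of `f`. -/
noncomputable def ofCantorCoeff (f : Ordinal.{u} →₀ ℕ) : Ordinal.{u} :=
  Ordinal.CNF.eval Ordinal.omega0 (f.mapRange (fun n : ℕ => (n : Ordinal.{u})) Nat.cast_zero)

/-- The natural sum `a ⊕ b`: Cantor normal forms are added coefficientwise. -/
noncomputable def natSum (a b : Ordinal.{u}) : Ordinal.{u} :=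
  ofCantorCoeff (cantorCoeff a + cantorCoeff b)

/-- The natural product `a ⊗ b`: Cantor normal forms are multiplied like polynomials in `ω`, the
exponents being added by the natural sum. -/
noncomputable def natProd (a b : Ordinal.{u}) : Ordinal.{u} :=
  ofCantorCoeff <| (cantorCoeff a).sum fun e m => (cantorCoeff b).sum fun f k =>
    Finsupp.single (natSum e f) (m * k)

/-- The natural product `a₁ ⊗ ⋯ ⊗ aₙ` of a finite family of ordinals. -/
noncomputable def bigNatProd {n : ℕ} (a : Fin n → Ordinal.{u}) : Ordinal.{u} :=
  (List.ofFn a).foldr natProd 1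

/-! ### Conditions on ordinals -/

/-- Infinite indecomposable ordinals: infinite, and closed under addition of smaller ordinals. -/
def IsInfiniteIndecomposable (a : Ordinal.{u}) : Prop :=
  Ordinal.omega0 ≤ a ∧ ∀ b < a, ∀ c < a, b + c < a

/-- All exponents in the Cantor normal form of `a` are infinite. -/
def OnlyInfiniteExponents (a : Ordinal.{u}) : Prop :=
  ∀ p ∈ Ordinal.CNF Ordinal.omega0 a, Ordinal.omega0 ≤ p.1

open Ordinal

/-! ### Natural sums in terms of Cantor coefficients -/

/-! Ranks are treated as game values: a move picks an element of a set and keeps only the elements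
related to it. Each factor is cut along the Cantor normal form of its type into pieces of types `ω ^
e`, with no element of a later piece below one of an earlier piece (`exists_list_pieces`). The
product is then covered by boxes, and expanding the natural product gives one monomial `ω ^ (e₁ ⊕ ⋯
⊕ eₙ)` per box (`bigNatProd_eq`).

Upper bound: width is at most maximal order type, type is subadditive for the natural sum, and a box
has type at most its monomial (`setOrderType_pi_le`).

Lower bound: the factor of index `i` is a single piece of type `ω ^ e` with `e ≠ 0`. Play in the
later boxes first. Elements of an earlier box whose `i`-th coordinate lies below none of those
already played are not below the played elements, and `setOrderType_sep_not_le` keeps the type of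
that coordinate at `ω ^ e`; the order of the pieces in another coordinate excludes the opposite
comparison. Hence widths of boxes add up (`sum_le_setWidth_slices`). The same device inside one box
gives it width at least its monomial, provided two exponents have the form `1 + b`
(`opow_le_setWidth_pi`); infinite exponents absorb the `1`. Listing boxes by descending monomials
turns the ordinal sum into the natural sum (`le_setWidth_pi`). -/

theorem cantorCoeff_ofCantorCoeff (f : Ordinal.{u} →₀ ℕ) : cantorCoeff (ofCantorCoeff f) = f := by
  rw [cantorCoeff, ofCantorCoeff, CNF.coeff_eval one_lt_omega0]
  · ext e; simp
  · intro e; simp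

theorem ofCantorCoeff_cantorCoeff (a : Ordinal.{u}) : ofCantorCoeff (cantorCoeff a) = a := by
  have h : ∀ e, CNF.coeff ω a e < ω := fun e => by
    by_cases he : e ∈ (CNF ω a).map Prod.fst
    · obtain ⟨⟨e, c⟩, hp, rfl⟩ := List.mem_map.1 he
      rw [CNF.coeff_of_mem_CNF hp]
      exact CNF.snd_lt one_lt_omega0 hp
    · rw [CNF.coeff_of_notMem_CNF he]; exact omega0_pos
  conv_rhs => rw [← CNF.eval_coeff ω a]
  rw [cantorCoeff, ofCantorCoeff]
  congr 1
  ext e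
  obtain ⟨n, hn⟩ := lt_omega0.1 (h e)
  simp [hn]

theorem ofCantorCoeff_injective : Function.Injective ofCantorCoeff.{u} :=
  Function.LeftInverse.injective cantorCoeff_ofCantorCoeff

theorem ofCantorCoeff_zero : ofCantorCoeff.{u} 0 = 0 := by
  simp [ofCantorCoeff]

theorem cantorCoeff_zero : cantorCoeff.{u} 0 = 0 := by
  rw [← ofCantorCoeff_zero, cantorCoeff_ofCantorCoeff]

theorem ofCantorCoeff_add {f g : Ordinal.{u} →₀ ℕ}
    (h : ∀ e₁ ∈ f.support, ∀ e₂ ∈ g.support, e₂ ≤ e₁) :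
    ofCantorCoeff (f + g) = ofCantorCoeff f + ofCantorCoeff g := by
  rw [ofCantorCoeff, Finsupp.mapRange_add (by intro x y; push_cast; rfl), CNF.eval_add]
  · rfl
  · intro e₁ h₁ e₂ h₂
    exact h e₁ (by simpa using h₁) e₂ (by simpa using h₂)

theorem ofCantorCoeff_single (e : Ordinal.{u}) (n : ℕ) :
    ofCantorCoeff (Finsupp.single e n) = ω ^ e * n := by
  simp [ofCantorCoeff]

theorem ofCantorCoeff_single_one (e : Ordinal.{u}) :
    ofCantorCoeff (Finsupp.single e 1) = ω ^ e := by
  simp [ofCantorCoeff_single]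

theorem cantorCoeff_opow (e : Ordinal.{u}) : cantorCoeff (ω ^ e) = Finsupp.single e 1 := by
  rw [← ofCantorCoeff_single_one, cantorCoeff_ofCantorCoeff]

theorem ofCantorCoeff_single_add {e : Ordinal.{u}} {f : Ordinal.{u} →₀ ℕ} (n : ℕ)
    (h : ∀ e' ∈ f.support, e' ≤ e) :
    ofCantorCoeff (Finsupp.single e n + f) = ω ^ e * n + ofCantorCoeff f := by
  rw [ofCantorCoeff_add, ofCantorCoeff_single]
  intro e₁ h₁ e₂ h₂
  have := Finsupp.support_single_subset h₁
  rw [Finset.mem_singleton.1 this]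
  exact h e₂ h₂

theorem ofCantorCoeff_lt_opow {f : Ordinal.{u} →₀ ℕ} {e : Ordinal.{u}}
    (h : ∀ e' ∈ f.support, e' < e) : ofCantorCoeff f < ω ^ e := by
  refine CNF.eval_lt (fun e' => by simp) fun e' he' => h e' (by simpa using he')

theorem lt_of_mem_support_cantorCoeff {a e : Ordinal.{u}} (ha : a < ω ^ e) {e' : Ordinal.{u}}
    (he' : e' ∈ (cantorCoeff a).support) : e' < e := by
  by_contra! h
  have : CNF.coeff ω a e' = 0 :=
    CNF.coeff_eq_zero_of_lt (ha.trans_le (opow_le_opow_right omega0_pos h))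
  simp [cantorCoeff, this] at he'

theorem ofCantorCoeff_add_lt_opow {f g : Ordinal.{u} →₀ ℕ} {e : Ordinal.{u}}
    (hf : ofCantorCoeff f < ω ^ e) (hg : ofCantorCoeff g < ω ^ e) :
    ofCantorCoeff (f + g) < ω ^ e := by
  refine ofCantorCoeff_lt_opow fun e' he' => ?_
  rcases Finset.mem_union.1 (Finsupp.support_add he') with h | h
  · exact lt_of_mem_support_cantorCoeff hf (by rwa [cantorCoeff_ofCantorCoeff])
  · exact lt_of_mem_support_cantorCoeff hg (by rwa [cantorCoeff_ofCantorCoeff])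

/-- The largest exponent at which the coefficients differ decides: the terms above it cancel, and
all terms below it sum to less than one further copy of `ω ^ e`. -/
theorem ofCantorCoeff_lt_of_colex {f g : Ordinal.{u} →₀ ℕ} {e : Ordinal.{u}} (he : f e < g e)
    (h : ∀ e' > e, f e' = g e') : ofCantorCoeff f < ofCantorCoeff g := by
  have split : ∀ k : Ordinal.{u} →₀ ℕ, ofCantorCoeff k =
      ofCantorCoeff (k.filter (e < ·)) +
        (ω ^ e * k e + ofCantorCoeff (k.filter (· < e))) := by
    intro k
    rw [← ofCantorCoeff_single_add, ← ofCantorCoeff_add]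
    · congr 1
      ext x
      rcases lt_trichotomy x e with hx | rfl | hx
      · simp [hx, hx.not_gt, hx.ne']
      · simp
      · simp [hx, hx.not_gt, hx.ne]
    · intro e₁ h₁ e₂ h₂
      have h₁ : e < e₁ := by simp at h₁; exact h₁.2
      rcases Finset.mem_union.1 (Finsupp.support_add h₂) with h | h
      · rw [Finset.mem_singleton.1 (Finsupp.support_single_subset h)]; exact h₁.le
      · simp at h; exact (h.2.trans h₁).le
    · intro e' he'
      simp at he'
      exact he'.2.le
  have hfg : f.filter (e < ·) = g.filter (e < ·) := by
    ext x
    by_cases hx : e < x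
    · simp [hx, h x hx]
    · simp [hx]
  rw [split f, split g, hfg, add_lt_add_iff_left]
  have hlow : ofCantorCoeff (f.filter (· < e)) < ω ^ e :=
    ofCantorCoeff_lt_opow fun e' he' => by simp at he'; exact he'.2
  calc ω ^ e * f e + ofCantorCoeff (f.filter (· < e)) < ω ^ e * f e + ω ^ e := by
        rwa [add_lt_add_iff_left]
    _ = ω ^ e * ((f e + 1 : ℕ) : Ordinal) := by rw [Nat.cast_add_one, mul_add_one]
    _ ≤ ω ^ e * g e := by gcongr; exact_mod_cast he
    _ ≤ _ := le_self_add

theorem exists_max_ne {f g : Ordinal.{u} →₀ ℕ} (h : f ≠ g) :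
    ∃ e, f e ≠ g e ∧ ∀ e' > e, f e' = g e' := by
  classical
  have hne : (f.neLocus g).Nonempty := Finsupp.nonempty_neLocus_iff.2 h
  refine ⟨(f.neLocus g).max' hne, by simpa using (f.neLocus g).max'_mem hne, fun e' he' => ?_⟩
  by_contra hc
  exact he'.not_ge ((f.neLocus g).le_max' e' (by simpa using hc))

theorem ofCantorCoeff_lt_iff {f g : Ordinal.{u} →₀ ℕ} :
    ofCantorCoeff f < ofCantorCoeff g ↔ ∃ e, f e < g e ∧ ∀ e' > e, f e' = g e' := by
  refine ⟨fun h => ?_, fun ⟨e, he, h⟩ => ofCantorCoeff_lt_of_colex he h⟩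
  obtain ⟨e, he, h'⟩ := exists_max_ne (f := f) (g := g) (by rintro rfl; exact h.false)
  rcases he.lt_or_gt with he | he
  · exact ⟨e, he, h'⟩
  · exact absurd (ofCantorCoeff_lt_of_colex he fun e' h => (h' e' h).symm) h.not_gt

theorem ofCantorCoeff_add_lt_add {f g : Ordinal.{u} →₀ ℕ} (k : Ordinal.{u} →₀ ℕ)
    (h : ofCantorCoeff f < ofCantorCoeff g) : ofCantorCoeff (f + k) < ofCantorCoeff (g + k) := by
  obtain ⟨e, he, h⟩ := ofCantorCoeff_lt_iff.1 h
  exact ofCantorCoeff_lt_iff.2 ⟨e, by simpa using he, fun e' he' => by simp [h e' he']⟩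

theorem ofCantorCoeff_add_le_add {f g f' g' : Ordinal.{u} →₀ ℕ}
    (h : ofCantorCoeff f ≤ ofCantorCoeff g) (h' : ofCantorCoeff f' ≤ ofCantorCoeff g') :
    ofCantorCoeff (f + f') ≤ ofCantorCoeff (g + g') := by
  have key : ∀ {f g : Ordinal.{u} →₀ ℕ} (k : Ordinal.{u} →₀ ℕ),
      ofCantorCoeff f ≤ ofCantorCoeff g → ofCantorCoeff (f + k) ≤ ofCantorCoeff (g + k) := by
    intro f g k h
    rcases h.lt_or_eq with h | h
    · exact (ofCantorCoeff_add_lt_add k h).le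
    · rw [ofCantorCoeff_injective h]
  refine (key f' h).trans ?_
  rw [add_comm g, add_comm g]
  exact key g h'

theorem ofCantorCoeff_le_of_le {f g : Ordinal.{u} →₀ ℕ} (h : f ≤ g) :
    ofCantorCoeff f ≤ ofCantorCoeff g := by
  obtain ⟨k, rfl⟩ := exists_add_of_le h
  simpa using ofCantorCoeff_add_le_add (f := f) (g := f) (f' := 0) (g' := k) le_rfl
    (by rw [ofCantorCoeff_zero]; exact zero_le)

theorem natSum_mono {a a' b b' : Ordinal.{u}} (ha : a ≤ a') (hb : b ≤ b') :
    natSum a b ≤ natSum a' b' :=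
  ofCantorCoeff_add_le_add (by simpa only [ofCantorCoeff_cantorCoeff])
    (by simpa only [ofCantorCoeff_cantorCoeff])

theorem natSum_lt_natSum_right {a b : Ordinal.{u}} (c : Ordinal.{u}) (h : a < b) :
    natSum a c < natSum b c :=
  ofCantorCoeff_add_lt_add _ (by simpa only [ofCantorCoeff_cantorCoeff])

theorem natSum_comm (a b : Ordinal.{u}) : natSum a b = natSum b a := by
  rw [natSum, natSum, add_comm]

theorem natSum_assoc (a b c : Ordinal.{u}) :
    natSum (natSum a b) c = natSum a (natSum b c) := by
  simp only [natSum, cantorCoeff_ofCantorCoeff, add_assoc]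

theorem natSum_ofCantorCoeff (f g : Ordinal.{u} →₀ ℕ) :
    natSum (ofCantorCoeff f) (ofCantorCoeff g) = ofCantorCoeff (f + g) := by
  simp only [natSum, cantorCoeff_ofCantorCoeff]

theorem natSum_lt_opow {a b e : Ordinal.{u}} (ha : a < ω ^ e) (hb : b < ω ^ e) :
    natSum a b < ω ^ e :=
  ofCantorCoeff_add_lt_opow (by simpa only [ofCantorCoeff_cantorCoeff])
    (by simpa only [ofCantorCoeff_cantorCoeff])

/-- An ordinal below a natural sum is still bounded by it after one summand is decreased. -/
theorem exists_lt_of_lt_natSum {c a b : Ordinal.{u}} (h : c < natSum a b) :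
    (∃ a' < a, c ≤ natSum a' b) ∨ ∃ b' < b, c ≤ natSum a b' := by
  have key : ∀ {f g k : Ordinal.{u} →₀ ℕ} {e : Ordinal.{u}}, k e < f e + g e →
      (∀ e' > e, k e' = f e' + g e') → f e ≠ 0 →
      ∃ f' : Ordinal.{u} →₀ ℕ, ofCantorCoeff f' < ofCantorCoeff f ∧ k ≤ f' + g := by
    intro f g k e he h h0
    have hval : ∀ x, (f.filter (e < ·) + Finsupp.single e (f e - 1) + k.filter (· < e)) x =
        if e < x then f x else if x = e then f e - 1 else k x := by
      intro x
      rcases lt_trichotomy x e with hx | rfl | hx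
      · simp [hx, hx.not_gt, hx.ne]
      · simp
      · simp [hx, hx.not_gt, hx.ne]
    -- Keep `f` above `e`, give up one copy of `ω ^ e`, and copy `k` below `e`: the loss at `e` pays
    -- for any lower coefficients.
    refine ⟨f.filter (e < ·) + Finsupp.single e (f e - 1) + k.filter (· < e), ?_, ?_⟩
    · refine ofCantorCoeff_lt_of_colex (e := e) ?_ fun e' he' => ?_
      · rw [hval]; simp; omega
      · rw [hval, if_pos he']
    · intro x
      rw [Finsupp.add_apply, hval]
      rcases lt_trichotomy x e with hx | rfl | hx
      · simp [hx.not_gt, hx.ne]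
      · simp; omega
      · simp [hx, h x hx]
  rw [natSum, ← ofCantorCoeff_cantorCoeff c, ofCantorCoeff_lt_iff] at h
  obtain ⟨e, he, h⟩ := h
  rw [Finsupp.add_apply] at he
  by_cases h0 : cantorCoeff a e = 0
  · right
    obtain ⟨g', hg', hk⟩ := key (f := cantorCoeff b) (g := cantorCoeff a) (by rwa [add_comm])
      (fun e' he' => by rw [h e' he', Finsupp.add_apply, add_comm]) (by omega)
    refine ⟨ofCantorCoeff g', by rwa [ofCantorCoeff_cantorCoeff] at hg', ?_⟩
    rw [natSum, cantorCoeff_ofCantorCoeff, add_comm]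
    conv_lhs => rw [← ofCantorCoeff_cantorCoeff c]
    exact ofCantorCoeff_le_of_le hk
  · left
    obtain ⟨g', hg', hk⟩ := key he (fun e' he' => by rw [h e' he', Finsupp.add_apply]) h0
    refine ⟨ofCantorCoeff g', by rwa [ofCantorCoeff_cantorCoeff] at hg', ?_⟩
    rw [natSum, cantorCoeff_ofCantorCoeff]
    conv_lhs => rw [← ofCantorCoeff_cantorCoeff c]
    exact ofCantorCoeff_le_of_le hk

/-- The natural sum of a finite family of ordinals. -/
noncomputable def bigNatSum {ι : Type*} [Fintype ι] (b : ι → Ordinal.{u}) : Ordinal.{u} :=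
  ofCantorCoeff (∑ j, cantorCoeff (b j))

theorem bigNatSum_update {ι : Type*} [Fintype ι] [DecidableEq ι] (b : ι → Ordinal.{u}) (j : ι)
    (c : Ordinal.{u}) : bigNatSum (Function.update b j c) =
      natSum c (ofCantorCoeff (∑ i ∈ Finset.univ.erase j, cantorCoeff (b i))) := by
  rw [bigNatSum, natSum, cantorCoeff_ofCantorCoeff,
    ← Finset.add_sum_erase _ _ (Finset.mem_univ j), Function.update_self]
  congr 2
  refine Finset.sum_congr rfl fun i hi => ?_
  rw [Function.update_of_ne (Finset.ne_of_mem_erase hi)]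

theorem bigNatSum_eq {ι : Type*} [Fintype ι] [DecidableEq ι] (b : ι → Ordinal.{u}) (j : ι) :
    bigNatSum b =
      natSum (b j) (ofCantorCoeff (∑ i ∈ Finset.univ.erase j, cantorCoeff (b i))) := by
  rw [← bigNatSum_update, Function.update_eq_self]

theorem bigNatSum_update_lt {ι : Type*} [Fintype ι] [DecidableEq ι] (b : ι → Ordinal.{u}) (j : ι)
    {c : Ordinal.{u}} (hc : c < b j) : bigNatSum (Function.update b j c) < bigNatSum b := by
  rw [bigNatSum_update, bigNatSum_eq b j]
  exact natSum_lt_natSum_right _ hc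

theorem bigNatSum_mono {ι : Type*} [Fintype ι] {b c : ι → Ordinal.{u}} (h : ∀ i, b i ≤ c i) :
    bigNatSum b ≤ bigNatSum c := by
  classical
  unfold bigNatSum
  induction (Finset.univ : Finset ι) using Finset.induction_on with
  | empty => simp
  | insert i s hi ih =>
    rw [Finset.sum_insert hi, Finset.sum_insert hi]
    exact ofCantorCoeff_add_le_add (by simpa only [ofCantorCoeff_cantorCoeff] using h i) ih

theorem exists_lt_of_lt_bigNatSum {ι : Type*} [Fintype ι] [DecidableEq ι] {b : ι → Ordinal.{u}}
    {c : Ordinal.{u}} (h : c < bigNatSum b) :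
    ∃ j, ∃ b' < b j, c ≤ bigNatSum (Function.update b j b') := by
  have key : ∀ (s : Finset ι) (c : Ordinal.{u}), c < ofCantorCoeff (∑ j ∈ s, cantorCoeff (b j)) →
      ∃ j ∈ s, ∃ b' < b j,
        c ≤ natSum b' (ofCantorCoeff (∑ i ∈ s.erase j, cantorCoeff (b i))) := by
    intro s
    induction s using Finset.induction_on with
    | empty => simp [ofCantorCoeff_zero]
    | insert i s hi ih =>
      intro c hc
      rw [Finset.sum_insert hi, ← natSum_ofCantorCoeff, ofCantorCoeff_cantorCoeff] at hc
      rcases exists_lt_of_lt_natSum hc with ⟨a', ha', hle⟩ | ⟨d, hd, hle⟩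
      · exact ⟨i, Finset.mem_insert_self _ _, a', ha', by rwa [Finset.erase_insert hi]⟩
      · obtain ⟨j, hj, b', hb', hle'⟩ := ih d hd
        refine ⟨j, Finset.mem_insert_of_mem hj, b', hb', hle.trans ?_⟩
        have hij : i ≠ j := by rintro rfl; exact hi hj
        rw [Finset.erase_insert_of_ne hij, Finset.sum_insert (by simp [hi]),
          ← natSum_ofCantorCoeff, ofCantorCoeff_cantorCoeff, ← natSum_assoc, natSum_comm b',
          natSum_assoc]
        exact natSum_mono le_rfl hle'
  obtain ⟨j, -, b', hb', hle⟩ := key Finset.univ c h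
  exact ⟨j, b', hb', by rwa [bigNatSum_update]⟩

/-! ### Descending sums of powers of `ω` -/

/-- In descending order no term is absorbed by a later one, so the ordinal sum agrees with the
natural sum. -/
theorem ofCantorCoeff_list_sum {l : List Ordinal.{u}} (hl : l.Pairwise (· ≥ ·)) :
    ofCantorCoeff (l.map fun e => Finsupp.single e 1).sum = (l.map fun e => ω ^ e).sum := by
  induction l with
  | nil => simp [ofCantorCoeff_zero]
  | cons e l ih =>
    rw [List.pairwise_cons] at hl
    rw [List.map_cons, List.sum_cons, List.map_cons, List.sum_cons, ← ih hl.2,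
      ofCantorCoeff_single_add, Nat.cast_one, mul_one]
    intro e' he'
    have : ∀ l : List Ordinal.{u},
        e' ∈ (l.map fun e => Finsupp.single e 1).sum.support → e' ∈ l := by
      intro l
      induction l with
      | nil => simp
      | cons a l ih =>
        intro h
        rw [List.map_cons, List.sum_cons] at h
        rcases Finset.mem_union.1 (Finsupp.support_add h) with h | h
        · rw [Finset.mem_singleton.1 (Finsupp.support_single_subset h)]; simp
        · exact List.mem_cons_of_mem _ (ih h)
    exact hl.1 e' (this l he')

theorem exists_list_cantorCoeff (f : Ordinal.{u} →₀ ℕ) :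
    ∃ l : List Ordinal.{u}, l.Pairwise (· ≥ ·) ∧ (∀ e ∈ l, e ∈ f.support) ∧
      f = (l.map fun e => Finsupp.single e 1).sum := by
  refine ⟨(Finsupp.toMultiset f).sort (· ≥ ·), Multiset.pairwise_sort _ _, ?_, ?_⟩
  · intro e he
    simpa using he
  · have : ∀ m : Multiset Ordinal.{u}, Multiset.toFinsupp m =
        (m.map fun e => Finsupp.single e 1).sum := by
      intro m
      induction m using Multiset.induction_on with
      | empty => simp
      | cons a m ih => rw [← Multiset.singleton_add, map_add, ih]; simp
    rw [← Multiset.sum_coe, ← Multiset.map_coe, Multiset.sort_eq, ← this]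
    simp

/-! ### Ranks of sets under residuals -/

section SetRank

variable {X : Type u} {R : X → X → Prop}

/-- `T` is obtained from `S` by choosing `x ∈ S` and keeping the elements related to `x`. -/
def Residual (R : X → X → Prop) (T S : Set X) : Prop :=
  ∃ x ∈ S, T = {y ∈ S | R x y}

theorem wellFounded_residual [LE X] [WellQuasiOrderedLE X] (hR : ∀ x y, R x y → ¬ x ≤ y) :
    WellFounded (Residual R) := by
  rw [wellFounded_iff_isEmpty_descending_chain]
  refine ⟨fun ⟨f, hf⟩ => ?_⟩
  choose x hx hfx using hf
  have hanti : Antitone f := antitone_nat_of_succ_le fun n => by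
    rw [hfx n]; exact Set.sep_subset _ _
  obtain ⟨m, n, hmn, hle⟩ := wellQuasiOrdered_le (α := X) x
  have : x n ∈ f (m + 1) := hanti hmn (hx n)
  rw [hfx m] at this
  exact hR _ _ this.2 hle

/-- The rank of a set, as the rank of the tree of sequences in it that are related pairwise. -/
noncomputable def setRank (h : WellFounded (Residual R)) (S : Set X) : Ordinal.{u} :=
  (h.apply S).rank

variable (h : WellFounded (Residual R))

/-- The working form of the rank: every bound below is obtained by exhibiting or analysing a first
move. -/
theorem lt_setRank_iff {S : Set X} {c : Ordinal.{u}} :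
    c < setRank h S ↔ ∃ x ∈ S, c ≤ setRank h {y ∈ S | R x y} := by
  rw [setRank, Acc.rank_eq, Ordinal.lt_iSup_iff]
  constructor
  · rintro ⟨⟨T, x, hx, rfl⟩, hc⟩
    exact ⟨x, hx, Order.lt_succ_iff.1 hc⟩
  · rintro ⟨x, hx, hc⟩
    exact ⟨⟨_, x, hx, rfl⟩, Order.lt_succ_iff.2 hc⟩

theorem setRank_residual_lt {S : Set X} {x : X} (hx : x ∈ S) :
    setRank h {y ∈ S | R x y} < setRank h S :=
  (lt_setRank_iff h).2 ⟨x, hx, le_rfl⟩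

theorem setRank_mono_rel {R' : X → X → Prop} (h' : WellFounded (Residual R'))
    (hR : ∀ x y, R x y → R' x y) {S T : Set X} (hST : S ⊆ T) : setRank h S ≤ setRank h' T := by
  induction S using h.induction generalizing T with
  | _ S ih =>
    refine le_of_forall_lt fun c hc => ?_
    obtain ⟨x, hx, hc⟩ := (lt_setRank_iff h).1 hc
    refine (lt_setRank_iff h').2 ⟨x, hST hx, hc.trans (ih _ ⟨x, hx, rfl⟩ ?_)⟩
    exact fun y hy => ⟨hST hy.1, hR _ _ hy.2⟩

theorem setRank_mono {S T : Set X} (hST : S ⊆ T) : setRank h S ≤ setRank h T :=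
  setRank_mono_rel h h (fun _ _ => id) hST

theorem setRank_pos {S : Set X} : 0 < setRank h S ↔ S.Nonempty := by
  rw [lt_setRank_iff]
  exact ⟨fun ⟨x, hx, _⟩ => ⟨x, hx⟩, fun ⟨x, hx⟩ => ⟨x, hx, zero_le⟩⟩

theorem setRank_empty : setRank h ∅ = 0 := by
  by_contra h0
  exact Set.not_nonempty_empty ((setRank_pos h).1 (pos_iff_ne_zero.2 h0))

/-- A move in `S ∪ T` lies in one of the two parts and strictly lowers its rank, and the natural sum
is strictly monotone in each argument. -/
theorem setRank_union_le (S T : Set X) :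
    setRank h (S ∪ T) ≤ natSum (setRank h S) (setRank h T) := by
  generalize hU : S ∪ T = U
  induction U using h.induction generalizing S T with
  | _ U ih =>
    subst hU
    refine le_of_forall_lt fun c hc => ?_
    obtain ⟨x, hx, hc⟩ := (lt_setRank_iff h).1 hc
    have key := ih _ ⟨x, hx, rfl⟩ {y ∈ S | R x y} {y ∈ T | R x y} (by ext y; simp [or_and_right])
    refine (hc.trans key).trans_lt ?_
    rcases hx with hx | hx
    · exact (natSum_mono le_rfl (setRank_mono h (Set.sep_subset _ _))).trans_lt
        (natSum_lt_natSum_right _ (setRank_residual_lt h hx))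
    · refine (natSum_mono (setRank_mono h (Set.sep_subset _ _)) le_rfl).trans_lt ?_
      rw [natSum_comm, natSum_comm (setRank h S)]
      exact natSum_lt_natSum_right _ (setRank_residual_lt h hx)

theorem setRank_iUnion_le {ι : Type*} (s : Finset ι) (S : ι → Set X)
    (f : ι → Ordinal.{u} →₀ ℕ) (hf : ∀ i ∈ s, setRank h (S i) ≤ ofCantorCoeff (f i)) :
    setRank h (⋃ i ∈ s, S i) ≤ ofCantorCoeff (∑ i ∈ s, f i) := by
  classical
  induction s using Finset.induction_on with
  | empty => simp [setRank_empty]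
  | insert i s hi ih =>
    rw [Finset.sum_insert hi, Finset.set_biUnion_insert, ← natSum_ofCantorCoeff]
    exact (setRank_union_le h _ _).trans (natSum_mono (hf i (by simp))
      (ih fun j hj => hf j (by simp [hj])))

theorem setRank_iUnion_lt_opow {ι : Type*} (s : Finset ι) (S : ι → Set X) {e : Ordinal.{u}}
    (hS : ∀ i ∈ s, setRank h (S i) < ω ^ e) : setRank h (⋃ i ∈ s, S i) < ω ^ e := by
  classical
  induction s using Finset.induction_on with
  | empty => simpa [setRank_empty] using opow_pos e omega0_pos
  | insert i s hi ih =>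
    rw [Finset.set_biUnion_insert]
    exact (setRank_union_le h _ _).trans_lt (natSum_lt_opow (hS i (by simp))
      (ih fun j hj => hS j (by simp [hj])))

/-- Playing first in `Y` and then in a part of rank at least `c` that always remains available. -/
theorem add_setRank_le {c : Ordinal.{u}} {S Y : Set X} (hY : Y ⊆ S)
    (hc : ∀ s : Finset X, (s : Set X) ⊆ Y → c ≤ setRank h {x ∈ S | ∀ y ∈ s, R y x}) :
    c + setRank h Y ≤ setRank h S := by
  classical
  induction Y using h.induction generalizing S with
  | _ Y ih =>
    refine le_of_forall_lt fun a ha => ?_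
    rcases lt_or_ge a c with hac | hac
    · exact hac.trans_le ((hc ∅ (by simp)).trans (setRank_mono h (Set.sep_subset _ _)))
    · obtain ⟨d, rfl⟩ := exists_add_of_le hac
      rw [add_lt_add_iff_left] at ha
      obtain ⟨y, hy, hd⟩ := (lt_setRank_iff h).1 ha
      refine lt_of_le_of_lt ?_ (setRank_residual_lt h (hY hy))
      refine le_trans (by gcongr) (ih _ ⟨y, hy, rfl⟩ (S := {x ∈ S | R y x}) ?_ ?_)
      · exact fun z hz => ⟨hY hz.1, hz.2⟩
      -- The hypothesis ranges over finite sets of moves so that it survives the move `y`: it is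
      -- applied with `y` inserted.
      · intro s hs
        refine (hc (insert y s) ?_).trans (setRank_mono h ?_)
        · intro z hz
          rcases Finset.mem_insert.1 (Finset.mem_coe.1 hz) with rfl | hz
          · exact hy
          · exact (hs hz).1
        · intro x hx
          exact ⟨⟨hx.1, hx.2 y (by simp)⟩, fun z hz => hx.2 z (by simp [hz])⟩

/-- The subtree above a node depends only on the set of elements that can still be appended. -/
theorem SeqTree.rank_eq_setRank (h' : WellFounded (SeqTree.IsChild (P := R))) :
    SeqTree.rank R h' = setRank h Set.univ := by
  have node : ∀ s : SeqTree R, (h'.apply s).rank = setRank h {y | ∀ x ∈ s.1, R x y} := by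
    intro s
    induction s using h'.induction with
    | _ s ih =>
      refine eq_of_forall_lt_iff fun c => ?_
      rw [Acc.rank_eq, Ordinal.lt_iSup_iff, lt_setRank_iff]
      have hset : ∀ y, {z | ∀ x ∈ s.1 ++ [y], R x z} = {z ∈ {z | ∀ x ∈ s.1, R x z} | R y z} := by
        intro y; ext z; simp [or_imp, forall_and]
      constructor
      · rintro ⟨⟨t, y, hy⟩, hc⟩
        have hc := Order.lt_succ_iff.1 hc
        rw [ih t ⟨y, hy⟩, hy, hset] at hc
        refine ⟨y, ?_, hc⟩
        have := t.2.2
        rw [hy, List.pairwise_append] at this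
        exact fun x hx => this.2.2 x hx y (by simp)
      · rintro ⟨y, hy, hc⟩
        let t : SeqTree R := ⟨s.1 ++ [y], by simp, by
          rw [List.pairwise_append]
          exact ⟨s.2.2, by simp, by simpa using hy⟩⟩
        refine ⟨⟨t, y, rfl⟩, Order.lt_succ_iff.2 ?_⟩
        rw [ih t ⟨y, rfl⟩]
        change c ≤ setRank h {z | ∀ x ∈ s.1 ++ [y], R x z}
        rwa [hset]
  refine eq_of_forall_lt_iff fun c => ?_
  rw [SeqTree.rank, Ordinal.lt_iSup_iff, lt_setRank_iff]
  constructor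
  · rintro ⟨s, hc⟩
    have hc := Order.lt_succ_iff.1 hc
    rw [node] at hc
    refine ⟨s.1.head s.2.1, Set.mem_univ _, hc.trans (setRank_mono h ?_)⟩
    exact fun y hy => ⟨Set.mem_univ _, hy _ (List.head_mem _)⟩
  · rintro ⟨x, -, hc⟩
    let t : SeqTree R := ⟨[x], by simp, by simp⟩
    refine ⟨t, Order.lt_succ_iff.2 ?_⟩
    rw [node t]
    refine hc.trans (setRank_mono h ?_)
    rintro y ⟨-, hy⟩ z hz
    rwa [List.mem_singleton.1 hz]

end SetRank

/-! ### Maximal order types and widths of subsets -/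

/-- The maximal order type of a subset of a well-quasi-order. -/
noncomputable def setOrderType {X : Type u} [LE X] [WellQuasiOrderedLE X] (S : Set X) :
    Ordinal.{u} :=
  setRank (R := fun x y : X => ¬ x ≤ y) (wellFounded_residual fun _ _ h => h) S

/-- The width of a subset of a well-quasi-order. -/
noncomputable def setWidth {X : Type u} [LE X] [WellQuasiOrderedLE X] (S : Set X) :
    Ordinal.{u} :=
  setRank (R := fun x y : X => ¬ x ≤ y ∧ ¬ y ≤ x) (wellFounded_residual fun _ _ h => h.1) S

section Split

variable {X : Type u} [Preorder X] [WellQuasiOrderedLE X]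

theorem maxOrderType_eq : maxOrderType X = setOrderType (Set.univ : Set X) :=
  SeqTree.rank_eq_setRank _ _

theorem wqoWidth_eq : wqoWidth X = setWidth (Set.univ : Set X) :=
  SeqTree.rank_eq_setRank _ _

theorem setWidth_le_setOrderType (S : Set X) : setWidth S ≤ setOrderType S :=
  setRank_mono_rel _ _ (fun _ _ h => h.1) subset_rfl

theorem setOrderType_pos {S : Set X} : 0 < setOrderType S ↔ S.Nonempty :=
  setRank_pos _

theorem setOrderType_mono {S T : Set X} (h : S ⊆ T) : setOrderType S ≤ setOrderType T :=
  setRank_mono _ h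

theorem setWidth_mono {S T : Set X} (h : S ⊆ T) : setWidth S ≤ setWidth T :=
  setRank_mono _ h

/-- Each move deletes an upward cone, so what remains is a lower part of `S`; moves are made until
the rank is exactly `c`. -/
theorem exists_lower_setOrderType_eq {S : Set X} {c : Ordinal.{u}} (hc : c ≤ setOrderType S) :
    ∃ D ⊆ S, setOrderType D = c ∧ ∀ u ∈ S \ D, ∀ d ∈ D, ¬ u ≤ d := by
  induction S using (wellFounded_residual (X := X) (R := fun x y => ¬ x ≤ y)
      fun _ _ h => h).induction with
  | _ S ih =>
    rcases hc.eq_or_lt with rfl | hc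
    · exact ⟨S, subset_rfl, rfl, by simp⟩
    · obtain ⟨x, hx, hc⟩ := (lt_setRank_iff _).1 hc
      obtain ⟨D, hD, hDc, hlow⟩ := ih _ ⟨x, hx, rfl⟩ hc
      refine ⟨D, hD.trans (Set.sep_subset _ _), hDc, fun u hu d hd hle => ?_⟩
      by_cases hxu : x ≤ u
      · exact (hD hd).2 (hxu.trans hle)
      · exact hlow u ⟨⟨hu.1, hxu⟩, hu.2⟩ d hd hle

theorem setOrderType_add_le {S D : Set X} (hD : D ⊆ S) (h : ∀ u ∈ S \ D, ∀ d ∈ D, ¬ u ≤ d) :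
    setOrderType D + setOrderType (S \ D) ≤ setOrderType S :=
  add_setRank_le _ Set.sdiff_subset fun _ hs => setRank_mono _
    fun d hd => ⟨hD hd, fun u hu => h u (hs hu) d hd⟩

/-- A set of type `ω ^ e₁ + ⋯ + ω ^ eₖ` in Cantor normal form splits into successive pieces of
types `ω ^ e₁`, …, `ω ^ eₖ`. -/
theorem exists_pieces {l : List Ordinal.{u}} (hl : l.Pairwise (· ≥ ·)) {S : Set X}
    (hS : setOrderType S = (l.map fun e => ω ^ e).sum) :
    ∃ P : Fin l.length → Set X, (∀ k, setOrderType (P k) = ω ^ l.get k) ∧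
      (∀ s t, s < t → ∀ d ∈ P s, ∀ u ∈ P t, ¬ u ≤ d) ∧ S = ⋃ k, P k := by
  induction l generalizing S with
  | nil =>
    refine ⟨fun _ => ∅, fun k => k.elim0, fun k => k.elim0, ?_⟩
    rw [Set.iUnion_eq_empty.2 fun _ => rfl, ← Set.not_nonempty_iff_eq_empty, ← setOrderType_pos, hS]
    simp
  | cons e l ih =>
    have hle : ω ^ e ≤ setOrderType S := by
      rw [hS, List.map_cons, List.sum_cons]; exact le_self_add
    obtain ⟨D, hD, hDe, hlow⟩ := exists_lower_setOrderType_eq hle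
    -- Ordinal superadditivity bounds the remainder from above; natural subadditivity bounds it from
    -- below.
    have hU : setOrderType (S \ D) = (l.map fun e => ω ^ e).sum := by
      apply le_antisymm
      · have := setOrderType_add_le hD hlow
        rwa [hDe, hS, List.map_cons, List.sum_cons, add_le_add_iff_left] at this
      · by_contra! hlt
        have h1 := setRank_union_le (wellFounded_residual (X := X) (R := fun x y => ¬ x ≤ y)
          fun _ _ h => h) D (S \ D)
        rw [Set.union_sdiff_cancel hD] at h1
        change setOrderType S ≤ natSum (setOrderType D) (setOrderType (S \ D)) at h1
        refine h1.not_gt ?_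
        rw [hDe, natSum_comm]
        refine (natSum_lt_natSum_right _ hlt).trans_eq ?_
        rw [hS, ← ofCantorCoeff_list_sum hl, ← ofCantorCoeff_list_sum hl.of_cons,
          ← ofCantorCoeff_single_one, natSum_ofCantorCoeff, List.map_cons, List.sum_cons, add_comm]
    obtain ⟨P, hP, hPlow, hPU⟩ := ih hl.of_cons hU
    refine ⟨Fin.cons D P, ?_, ?_, ?_⟩
    · exact Fin.cases hDe hP
    · intro s t hst d hd u hu
      induction t using Fin.cases with
      | zero => exact absurd hst (Fin.not_lt_zero _)
      | succ t =>
        rw [Fin.cons_succ] at hu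
        induction s using Fin.cases with
        | zero =>
          rw [Fin.cons_zero] at hd
          exact hlow u (by rw [hPU]; exact Set.mem_iUnion_of_mem t hu) d hd
        | succ s =>
          rw [Fin.cons_succ] at hd
          exact hPlow s t (Fin.succ_lt_succ_iff.1 hst) d hd u hu
    · ext x
      change _ ↔ x ∈ ⋃ k : Fin (l.length + 1), (Fin.cons D P : Fin (l.length + 1) → Set X) k
      rw [Set.mem_iUnion, Fin.exists_fin_succ, ← Set.union_sdiff_cancel hD, hPU]
      simp

theorem exists_list_pieces (S : Set X) :
    ∃ (l : List Ordinal.{u}) (P : Fin l.length → Set X), l.Pairwise (· ≥ ·) ∧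
      (∀ e ∈ l, e ∈ (cantorCoeff (setOrderType S)).support) ∧
      cantorCoeff (setOrderType S) = ∑ k, Finsupp.single (l.get k) 1 ∧
      (∀ k, setOrderType (P k) = ω ^ l.get k) ∧
      (∀ s t, s < t → ∀ d ∈ P s, ∀ u ∈ P t, ¬ u ≤ d) ∧ S = ⋃ k, P k := by
  obtain ⟨l, hl, hmem, hsum⟩ := exists_list_cantorCoeff (cantorCoeff (setOrderType S))
  obtain ⟨P, hP⟩ := exists_pieces hl (S := S) (by
    rw [← ofCantorCoeff_list_sum hl, ← hsum, ofCantorCoeff_cantorCoeff])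
  refine ⟨l, P, hl, hmem, ?_, hP⟩
  rw [hsum]
  conv_lhs => rw [← List.ofFn_get l, List.map_ofFn, List.sum_ofFn]
  rfl

/-- Removing finitely many lower sets does not affect an infinite indecomposable type. -/
theorem setOrderType_sep_not_le {T : Set X} {e : Ordinal.{u}} (he : e ≠ 0)
    (hT : setOrderType T = ω ^ e) (s : Finset X) (hs : (s : Set X) ⊆ T) :
    setOrderType {y ∈ T | ∀ x ∈ s, ¬ y ≤ x} = ω ^ e := by
  refine le_antisymm (hT ▸ setOrderType_mono (Set.sep_subset _ _)) ?_
  by_contra! hlt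
  have hone : ∀ x : X, setOrderType {y | y ≤ x ∧ x ≤ y} < ω ^ e := by
    intro x
    have : setOrderType {y | y ≤ x ∧ x ≤ y} ≤ 1 := by
      by_contra! h1
      obtain ⟨y, hy, h1⟩ := (lt_setRank_iff _).1 h1
      obtain ⟨z, hz, hyz⟩ := (setRank_pos _).1 (Order.one_le_iff_pos.1 h1)
      exact hyz (hy.1.trans hz.2)
    exact this.trans_lt (one_lt_opow.2 ⟨one_lt_omega0, he⟩)
  -- Below `x` lie elements not above `x`, which form part of a proper residual of `T`, and elements
  -- equivalent to `x`, which have type at most `1`.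
  have hdown : ∀ x ∈ s, setOrderType {y ∈ T | y ≤ x} < ω ^ e := by
    intro x hx
    have hsub : {y ∈ T | y ≤ x} ⊆ {y ∈ T | ¬ x ≤ y} ∪ {y | y ≤ x ∧ x ≤ y} := by
      intro y hy
      by_cases h : x ≤ y
      · exact Or.inr ⟨hy.2, h⟩
      · exact Or.inl ⟨hy.1, h⟩
    exact ((setOrderType_mono hsub).trans (setRank_union_le _ _ _)).trans_lt
      (natSum_lt_opow ((setRank_residual_lt _ (hs hx)).trans_eq hT) (hone x))
  have hunion : T ⊆ {y ∈ T | ∀ x ∈ s, ¬ y ≤ x} ∪ ⋃ x ∈ s, {y ∈ T | y ≤ x} := by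
    intro y hy
    by_cases h : ∀ x ∈ s, ¬ y ≤ x
    · exact Or.inl ⟨hy, h⟩
    · push Not at h
      obtain ⟨x, hx, hyx⟩ := h
      exact Or.inr (Set.mem_biUnion hx ⟨hy, hyx⟩)
  refine (((setOrderType_mono hunion).trans (setRank_union_le _ _ _)).trans_lt
    (natSum_lt_opow hlt (setRank_iUnion_lt_opow _ s _ hdown))).ne hT

end Split

/-! ### Finite products -/

section Product

variable {ι : Type} [Fintype ι] [DecidableEq ι] {A : ι → Type u} [∀ j, Preorder (A j)]
  [∀ j, WellQuasiOrderedLE (A j)]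

/-- After a move `x`, any remaining element fails to dominate `x` in some coordinate `j`. That
factor shrinks to a type below `ω ^ a j`, hence splits into pieces with smaller exponents; finitely
many smaller boxes stay below `ω ^ N`. -/
theorem setOrderType_pi_le_opow {a : ι → Ordinal.{u}} {S : ∀ j, Set (A j)}
    (hS : ∀ j, setOrderType (S j) = ω ^ a j) :
    setOrderType (Set.univ.pi S) ≤ ω ^ bigNatSum a := by
  generalize hN : bigNatSum a = N
  induction N using WellFoundedLT.induction generalizing a S with
  | _ N ih =>
    refine le_of_forall_lt fun c hc => ?_
    obtain ⟨x, hx, hc⟩ := (lt_setRank_iff _).1 hc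
    refine hc.trans_lt ?_
    let T : ∀ j, Set (A j) := fun j => {y ∈ S j | ¬ x j ≤ y}
    have hsub : {y ∈ Set.univ.pi S | ¬ x ≤ y} ⊆
        ⋃ j ∈ (Finset.univ : Finset ι), Set.univ.pi (Function.update S j (T j)) := by
      rintro y ⟨hy, hxy⟩
      rw [Pi.le_def] at hxy
      push Not at hxy
      obtain ⟨j, hj⟩ := hxy
      refine Set.mem_biUnion (Finset.mem_coe.2 (Finset.mem_univ j)) fun j' _ => ?_
      by_cases h : j' = j
      · subst h; rw [Function.update_self]; exact ⟨hy j' trivial, hj⟩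
      · rw [Function.update_of_ne h]; exact hy j' trivial
    refine (setRank_mono _ hsub).trans_lt (setRank_iUnion_lt_opow _ _ _ fun j _ => ?_)
    have hT : setOrderType (T j) < ω ^ a j :=
      (setRank_residual_lt _ (hx j trivial)).trans_eq (hS j)
    obtain ⟨l, P, -, hl, -, hP, -, hTP⟩ := exists_list_pieces (T j)
    have hsub' : Set.univ.pi (Function.update S j (T j)) ⊆
        ⋃ k ∈ (Finset.univ : Finset (Fin l.length)),
          Set.univ.pi (Function.update S j (P k)) := by
      intro y hy
      have hyj := hy j trivial
      rw [Function.update_self, hTP] at hyj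
      obtain ⟨k, hk⟩ := Set.mem_iUnion.1 hyj
      refine Set.mem_biUnion (Finset.mem_coe.2 (Finset.mem_univ k)) fun j' _ => ?_
      by_cases h : j' = j
      · subst h; rwa [Function.update_self]
      · have := hy j' trivial
        rwa [Function.update_of_ne h] at this ⊢
    refine (setRank_mono _ hsub').trans_lt (setRank_iUnion_lt_opow _ _ _ fun k _ => ?_)
    have hlt : bigNatSum (Function.update a j (l.get k)) < N := by
      rw [← hN]
      exact bigNatSum_update_lt _ _
        (lt_of_mem_support_cantorCoeff hT (hl _ (List.get_mem _ _)))
    refine (ih _ hlt (S := Function.update S j (P k)) (fun j' => ?_) rfl).trans_lt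
      ((opow_lt_opow_iff_right one_lt_omega0).2 hlt)
    by_cases h : j' = j
    · subst h; simpa using hP k
    · simpa [h] using hS j'

theorem setOrderType_pi_le {m : ι → ℕ} {b : ∀ j, Fin (m j) → Ordinal.{u}} {S : ∀ j, Set (A j)}
    {P : ∀ j, Fin (m j) → Set (A j)} (hP : ∀ j k, setOrderType (P j k) = ω ^ b j k)
    (hS : ∀ j, S j = ⋃ k, P j k) :
    setOrderType (Set.univ.pi S) ≤ ofCantorCoeff
      (∑ k : ∀ j, Fin (m j), Finsupp.single (bigNatSum fun j => b j (k j)) 1) := by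
  have hsub : Set.univ.pi S ⊆
      ⋃ k ∈ (Finset.univ : Finset (∀ j, Fin (m j))), Set.univ.pi fun j => P j (k j) := by
    intro x hx
    have : ∀ j, ∃ k, x j ∈ P j k := fun j => by
      have := hx j trivial
      rwa [hS j, Set.mem_iUnion] at this
    choose k hk using this
    exact Set.mem_biUnion (Finset.mem_coe.2 (Finset.mem_univ k)) fun j _ => hk j
  refine (setRank_mono _ hsub).trans (setRank_iUnion_le _ _ _ _ fun k _ => ?_)
  rw [ofCantorCoeff_single_one]
  exact setOrderType_pi_le_opow fun j => hP j (k j)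

theorem sum_le_setWidth_slices {κ : Type*} (i : ι) {e : Ordinal.{u}} (he : e ≠ 0)
    {Q : κ → ∀ j, Set (A j)} {ρ : κ → Ordinal.{u}} {L : List κ}
    (hL : L.Pairwise fun k k' => ∃ j ≠ i, ∀ d ∈ Q k j, ∀ u ∈ Q k' j, ¬ u ≤ d)
    (hw : ∀ k ∈ L, ∀ T : Set (A i), setOrderType T = ω ^ e →
      ρ k ≤ setWidth (Set.univ.pi (Function.update (Q k) i T)))
    {T : Set (A i)} (hT : setOrderType T = ω ^ e) :
    (L.map ρ).sum ≤ setWidth (⋃ k ∈ L, Set.univ.pi (Function.update (Q k) i T)) := by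
  classical
  induction L with
  | nil => simp
  | cons k L ih =>
    rw [List.pairwise_cons] at hL
    have ih := ih hL.2 fun k' hk' => hw k' (List.mem_cons_of_mem _ hk')
    rw [List.map_cons, List.sum_cons]
    refine (add_le_add_right ih _).trans (add_setRank_le _ ?_ ?_)
    · exact Set.biUnion_subset_biUnion_left fun k' hk' => List.mem_cons_of_mem _ hk'
    · intro s hs
      have hsi : ((s.image fun x => x i : Finset (A i)) : Set (A i)) ⊆ T := by
        intro y hy
        obtain ⟨x, hx, rfl⟩ := Finset.mem_image.1 (Finset.mem_coe.1 hy)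
        obtain ⟨k', -, hxk⟩ := Set.mem_iUnion₂.1 (hs hx)
        simpa using hxk i trivial
      refine (hw k (by simp) _ (setOrderType_sep_not_le he hT _ hsi)).trans (setRank_mono _ ?_)
      intro x hx
      have hxi := hx i trivial
      rw [Function.update_self] at hxi
      refine ⟨Set.mem_biUnion (List.mem_cons_self : k ∈ k :: L) fun j _ => ?_,
        fun y hy => ⟨fun hle => ?_, fun hle => ?_⟩⟩
      · have hxj := hx j trivial
        by_cases h : j = i
        · subst h; rw [Function.update_self]; exact hxi.1
        · rwa [Function.update_of_ne h] at hxj ⊢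
      · obtain ⟨k', hk', hyk⟩ := Set.mem_iUnion₂.1 (hs hy)
        obtain ⟨j, hj, hlow⟩ := hL.1 k' hk'
        have h1 := hx j trivial
        have h2 := hyk j trivial
        rw [Function.update_of_ne hj] at h1 h2
        exact hlow _ h1 _ h2 (hle j)
      · exact hxi.2 (y i) (Finset.mem_image_of_mem _ hy) (hle i)

theorem opow_le_setWidth_pi {i₁ i₂ : ι} (hi : i₁ ≠ i₂) {b : ι → Ordinal.{u}}
    {S : ∀ j, Set (A j)}
    (hS : ∀ j, setOrderType (S j) = ω ^ (if j = i₁ ∨ j = i₂ then 1 + b j else b j)) :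
    ω ^ bigNatSum b ≤ setWidth (Set.univ.pi S) := by
  generalize hN : bigNatSum b = N
  induction N using WellFoundedLT.induction generalizing b S with
  | _ N ih =>
    refine le_of_forall_lt fun c hc => ?_
    by_cases hN0 : N = 0
    · rw [hN0, opow_zero, Order.lt_one_iff] at hc
      rw [hc]
      refine (setRank_pos _).2 (Set.univ_pi_nonempty_iff.2 fun j => setOrderType_pos.1 ?_)
      rw [hS j]
      exact opow_pos _ omega0_pos
    obtain ⟨c', hc', m, hcm⟩ := (lt_omega0_opow hN0).1 hc
    rw [← hN] at hc'
    -- It suffices to stack `m` boxes whose exponent is lowered in the single coordinate `j`; they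
    -- are cut from a part of `S j` of type `ω ^ f' * m`.
    obtain ⟨j, b', hb', hle⟩ := exists_lt_of_lt_bigNatSum hc'
    set f' := if j = i₁ ∨ j = i₂ then 1 + b' else b' with hf'
    have hlt : f' < if j = i₁ ∨ j = i₂ then 1 + b j else b j := by
      rw [hf']
      split_ifs
      · rwa [add_lt_add_iff_left]
      · exact hb'
    have hsum : ∀ x : Ordinal.{u}, ((List.replicate m x).map fun e => ω ^ e).sum = ω ^ x * m := by
      intro x
      rw [List.map_replicate, List.sum_replicate, nsmul_eq_mul]
    have hDle : ω ^ f' * m ≤ setOrderType (S j) := by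
      rw [hS j]
      exact (opow_mul_lt_opow (natCast_lt_omega0 m) hlt).le
    obtain ⟨D, hDS, hD, -⟩ := exists_lower_setOrderType_eq hDle
    rw [← hsum] at hD
    obtain ⟨P, hP, hPlow, hDP⟩ := exists_pieces (by simp [List.pairwise_replicate]) hD
    -- The avoiding coordinate must differ from the sliced one, hence two special indices; the form
    -- `1 + b i` keeps its exponent nonzero even when `b i = 0`.
    obtain ⟨i, hij, hi12⟩ : ∃ i, i ≠ j ∧ (i = i₁ ∨ i = i₂) := by
      by_cases h : j = i₁
      · exact ⟨i₂, by rw [h]; exact hi.symm, Or.inr rfl⟩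
      · exact ⟨i₁, Ne.symm h, Or.inl rfl⟩
    have hlt' : bigNatSum (Function.update b j b') < N := hN ▸ bigNatSum_update_lt _ _ hb'
    have hSi := hS i
    rw [if_pos hi12] at hSi
    have key := sum_le_setWidth_slices (A := A) i (e := 1 + b i) (by simp)
      (Q := fun k => Function.update S j (P k))
      (ρ := fun _ => ω ^ bigNatSum (Function.update b j b'))
      (L := List.finRange _)
      ((List.pairwise_lt_finRange _).imp fun {k k'} hk =>
        ⟨j, hij.symm, by simpa only [Function.update_self] using hPlow k k' hk⟩)
      (fun k _ T hT => ih _ hlt' (fun j' => by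
        by_cases h : j' = i
        · subst h
          simp only [Function.update_self, if_pos hi12, Function.update_of_ne hij, hT]
        · rw [Function.update_of_ne h]
          by_cases h' : j' = j
          · subst h'
            rw [Function.update_self, Function.update_self, hP]
            simp [hf']
          · rw [Function.update_of_ne h', Function.update_of_ne h', hS]) rfl) hSi
    refine lt_of_lt_of_le (hcm.trans_le ?_) (key.trans (setWidth_mono ?_))
    · rw [List.map_const', List.length_finRange, List.length_replicate]
      have := hsum (bigNatSum (Function.update b j b'))
      rw [List.map_replicate] at this
      rw [this]
      gcongr
      exact omega0_pos
    · refine Set.iUnion₂_subset fun k _ x hx j' _ => ?_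
      have := hx j' trivial
      by_cases h : j' = i
      · subst h; simpa using this
      · rw [Function.update_of_ne h] at this
        by_cases h' : j' = j
        · subst h'
          rw [Function.update_self] at this
          exact hDS (hDP ▸ Set.mem_iUnion_of_mem k this)
        · rwa [Function.update_of_ne h'] at this

theorem le_setWidth_pi {l : ι → List Ordinal.{u}} {S : ∀ j, Set (A j)}
    {P : ∀ j, Fin (l j).length → Set (A j)} (hl : ∀ j, (l j).Pairwise (· ≥ ·))
    (hP : ∀ j k, setOrderType (P j k) = ω ^ (l j).get k)
    (hlow : ∀ j s t, s < t → ∀ d ∈ P j s, ∀ u ∈ P j t, ¬ u ≤ d)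
    (hS : ∀ j, S j = ⋃ k, P j k) {i i₁ i₂ : ι} {e : Ordinal.{u}} (he : e ≠ 0) (hi : l i = [e])
    (h₁₂ : i₁ ≠ i₂) (h₁ : ∀ x ∈ l i₁, ω ≤ x) (h₂ : ∀ x ∈ l i₂, ω ≤ x) :
    ofCantorCoeff (∑ k : ∀ j, Fin (l j).length,
      Finsupp.single (bigNatSum fun j => (l j).get (k j)) 1) ≤ setWidth (Set.univ.pi S) := by
  let E : (∀ j, Fin (l j).length) → Ordinal.{u} := fun k => bigNatSum fun j => (l j).get (k j)
  -- Larger monomials come first; ties are broken by the smaller index sum.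
  let r : (∀ j, Fin (l j).length) → (∀ j, Fin (l j).length) → Prop := fun k k' =>
    E k' < E k ∨ E k = E k' ∧ ∑ j, (k j : ℕ) ≤ ∑ j, (k' j : ℕ)
  classical
  have : Std.Total r := ⟨fun k k' => by
    rcases lt_trichotomy (E k) (E k') with h | h | h
    · exact Or.inr (Or.inl h)
    · rcases le_total (∑ j, (k j : ℕ)) (∑ j, (k' j : ℕ)) with h' | h'
      · exact Or.inl (Or.inr ⟨h, h'⟩)
      · exact Or.inr (Or.inr ⟨h.symm, h'⟩)
    · exact Or.inl (Or.inl h)⟩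
  have : IsTrans _ r := ⟨fun a b c hab hbc => by
    rcases hab with hab | hab <;> rcases hbc with hbc | hbc
    · exact Or.inl (hbc.trans hab)
    · exact Or.inl (hbc.1 ▸ hab)
    · exact Or.inl (hab.1 ▸ hbc)
    · exact Or.inr ⟨hab.1.trans hbc.1, hab.2.trans hbc.2⟩⟩
  let L := (Finset.univ : Finset (∀ j, Fin (l j).length)).toList.insertionSort r
  have hperm : L.Perm (Finset.univ : Finset (∀ j, Fin (l j).length)).toList :=
    List.perm_insertionSort _ _
  have hsorted : L.Pairwise r := List.pairwise_insertionSort _ _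
  have hnodup : L.Nodup := hperm.nodup_iff.2 (Finset.nodup_toList _)
  have hone : ∀ x y : Fin (l i).length, x = y := by
    rw [hi]; intro x y; exact Subsingleton.elim (α := Fin 1) x y
  have hget : ∀ x : Fin (l i).length, (l i).get x = e := fun x => by
    have := List.get_mem (l i) x
    generalize (l i).get x = y at this ⊢
    rwa [hi, List.mem_singleton] at this
  -- If no coordinate moves to a later piece, then `k' ≤ k` everywhere, so `k'` has at least as
  -- large a monomial and a strictly smaller index sum: it would have been listed first.
  have hslice : L.Pairwise fun k k' =>
      ∃ j ≠ i, ∀ d ∈ P j (k j), ∀ u ∈ P j (k' j), ¬ u ≤ d := by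
    refine (hsorted.and hnodup).imp fun {k k'} ⟨hr, hne⟩ => ?_
    by_contra! hcon
    have hle : ∀ j, k' j ≤ k j := by
      intro j
      by_cases hj : j = i
      · subst hj; exact (hone _ _).le
      · by_contra! hlt
        obtain ⟨d, hd, u, hu, hdu⟩ := hcon j hj
        exact hlow j _ _ hlt d hd u hu hdu
    have hE : E k ≤ E k' := bigNatSum_mono fun j => by
      rcases (hle j).eq_or_lt with h | h
      · rw [h]
      · exact List.pairwise_iff_get.1 (hl j) _ _ h
    have hsum : ∑ j, (k' j : ℕ) < ∑ j, (k j : ℕ) := by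
      obtain ⟨j, hj⟩ := Function.ne_iff.1 hne
      exact Finset.sum_lt_sum (fun j _ => hle j) ⟨j, Finset.mem_univ _, (hle j).lt_of_ne' hj⟩
    rcases hr with hr | hr
    · exact hE.not_gt hr
    · exact hr.2.not_gt hsum
  have hdesc : (L.map E).Pairwise (· ≥ ·) := by
    rw [List.pairwise_map]
    exact hsorted.imp fun {k k'} hr => hr.elim le_of_lt fun h => h.1.ge
  have hsum : ofCantorCoeff (∑ k : ∀ j, Fin (l j).length, Finsupp.single (E k) 1) =
      (L.map fun k => ω ^ E k).sum := by
    have := ofCantorCoeff_list_sum hdesc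
    rw [List.map_map, List.map_map] at this
    refine Eq.trans ?_ this
    rw [(hperm.map _).sum_eq, Finset.sum_map_toList]
    rfl
  have hSi : setOrderType (S i) = ω ^ e := by
    let k : Fin (l i).length := ⟨0, by simp [hi]⟩
    have : S i = P i k := by
      rw [hS i]
      exact subset_antisymm (Set.iUnion_subset fun k' => by rw [hone k' k])
        (Set.subset_iUnion _ k)
    rw [this, hP, hget]
  refine (hsum.trans_le (sum_le_setWidth_slices i he (Q := fun k j => P j (k j)) hslice
    (fun k _ T hT => opow_le_setWidth_pi h₁₂ fun j => ?_) hSi)).trans (setWidth_mono ?_)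
  · have hb : (if j = i₁ ∨ j = i₂ then 1 + (l j).get (k j) else (l j).get (k j)) =
        (l j).get (k j) := by
      split_ifs with h
      · refine one_add_of_omega0_le ?_
        rcases h with rfl | rfl
        · exact h₁ _ (List.get_mem _ _)
        · exact h₂ _ (List.get_mem _ _)
      · rfl
    rw [hb]
    by_cases h : j = i
    · subst h; rw [Function.update_self, hT, hget]
    · rw [Function.update_of_ne h, hP]
  · refine Set.iUnion₂_subset fun k _ x hx j _ => ?_
    have := hx j trivial
    by_cases h : j = i
    · subst h; simpa using this
    · rw [Function.update_of_ne h] at this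
      rw [hS j]
      exact Set.mem_iUnion_of_mem _ this

end Product

/-! ### Natural products -/

theorem natProd_eq {κ ν : Type*} [Fintype κ] [Fintype ν] {a b : Ordinal.{u}}
    {x : κ → Ordinal.{u}} {y : ν → Ordinal.{u}}
    (ha : cantorCoeff a = ∑ k, Finsupp.single (x k) 1)
    (hb : cantorCoeff b = ∑ k, Finsupp.single (y k) 1) :
    natProd a b = ofCantorCoeff (∑ k, ∑ k', Finsupp.single (natSum (x k) (y k')) 1) := by
  rw [natProd, ha, ← Finsupp.sum_finsetSum_index]
  · congr 1
    refine Finset.sum_congr rfl fun k _ => ?_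
    rw [Finsupp.sum_single_index, hb, ← Finsupp.sum_finsetSum_index]
    · simp
    · simp
    · intro e m n; rw [mul_add, Finsupp.single_add]
    · simp
  · simp
  · intro e m n
    simp [add_mul, Finsupp.sum_add]

/-- Distributivity indexes the monomials by choice functions, the same index set as the boxes. -/
theorem bigNatProd_eq {n : ℕ} {a : Fin n → Ordinal.{u}} {m : Fin n → ℕ}
    {b : ∀ j, Fin (m j) → Ordinal.{u}}
    (h : ∀ j, cantorCoeff (a j) = ∑ k, Finsupp.single (b j k) 1) :
    bigNatProd a = ofCantorCoeff
      (∑ k : ∀ j, Fin (m j), Finsupp.single (bigNatSum fun j => b j (k j)) 1) := by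
  induction n with
  | zero =>
    simp [bigNatProd, bigNatSum, ofCantorCoeff_zero, ofCantorCoeff_single_one]
  | succ n ih =>
    have ih := ih fun j => h j.succ
    have hc := congrArg cantorCoeff ih
    rw [cantorCoeff_ofCantorCoeff] at hc
    have : bigNatProd a = natProd (a 0) (bigNatProd fun j => a j.succ) := by
      simp [bigNatProd, List.ofFn_succ]
    rw [this, natProd_eq (h 0) hc, ← Fintype.sum_prod_type']
    congr 1
    refine Fintype.sum_equiv (Fin.consEquiv fun j => Fin (m j)) _ _ fun k => ?_
    congr 1
    rw [natSum, bigNatSum, bigNatSum, cantorCoeff_ofCantorCoeff, Fin.sum_univ_succ]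
    rfl

theorem IsInfiniteIndecomposable.exists_eq_opow {a : Ordinal.{u}}
    (h : IsInfiniteIndecomposable a) : ∃ e : Ordinal.{u}, e ≠ 0 ∧ a = ω ^ e := by
  rcases isPrincipal_add_iff_zero_or_omega0_opow.1 (fun b c hb hc => h.2 b hb c hc) with h0 | ⟨e, he⟩
  · exact absurd h.1 (by rw [h0]; exact omega0_pos.not_ge)
  · refine ⟨e, ?_, he.symm⟩
    rintro rfl
    refine h.1.not_gt ?_
    rw [← he]
    simp

theorem OnlyInfiniteExponents.omega0_le {a : Ordinal.{u}} (h : OnlyInfiniteExponents a)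
    {e : Ordinal.{u}} (he : e ∈ (cantorCoeff a).support) : ω ≤ e := by
  have : e ∈ (CNF.coeff ω a).support := Finsupp.support_mapRange he
  rw [CNF.support_coeff, List.mem_toFinset, List.mem_map] at this
  obtain ⟨p, hp, rfl⟩ := this
  exact h p hp

theorem mainTheorem5 {n : ℕ} (A : Fin n → Type u) [∀ i, Preorder (A i)]
    [∀ i, WellQuasiOrderedLE (A i)]
    (hindec : ∃ i, IsInfiniteIndecomposable (maxOrderType (A i)))
    (hexp : ∃ j₁ j₂, j₁ ≠ j₂ ∧ OnlyInfiniteExponents (maxOrderType (A j₁)) ∧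
      OnlyInfiniteExponents (maxOrderType (A j₂))) :
    wqoWidth (∀ i, A i) = bigNatProd fun i => maxOrderType (A i) := by
  obtain ⟨i, hi⟩ := hindec
  obtain ⟨j₁, j₂, hj, h₁, h₂⟩ := hexp
  obtain ⟨e, he, hie⟩ := hi.exists_eq_opow
  simp only [maxOrderType_eq] at *
  choose l P hl hmem hsum hP hlow hS using fun j => exists_list_pieces (Set.univ : Set (A j))
  rw [bigNatProd_eq hsum, wqoWidth_eq]
  -- The normal form `ω ^ e` has one term, so the factor `A i` is not cut.
  have hli : l i = [e] := by
    have hall : ∀ x ∈ l i, x = e := fun x hx => by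
      have := hmem i x hx
      rw [hie, cantorCoeff_opow] at this
      exact Finset.mem_singleton.1 (Finsupp.support_single_subset this)
    have hlen : (l i).length = 1 := by
      have := congrArg (fun f => f e) (hsum i)
      simp only [hie, cantorCoeff_opow, Finsupp.finsetSum_apply] at this
      rw [Finset.sum_congr rfl fun k _ => by rw [hall _ (List.get_mem (l i) k)]] at this
      simpa using this.symm
    obtain ⟨x, hx⟩ := List.length_eq_one_iff.1 hlen
    rw [hx, hall x (by simp [hx])]
  rw [← Set.pi_univ Set.univ]
  apply le_antisymm
  · exact (setWidth_le_setOrderType _).trans (setOrderType_pi_le hP hS)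
  · exact le_setWidth_pi hl hP hlow hS he hli hj (fun x hx => h₁.omega0_le (hmem j₁ x hx))
      fun x hx => h₂.omega0_le (hmem j₂ x hx)
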